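/- Let $D\subseteq\mathbb R^{n}$ be measurable, $Y$ a finite set, $f:D\to\mathbb R^{n}$ and $h:D\to Y$ measurable, and consider $x_{t+1}=f(x_t)$, $y_t=h(x_t)$, $x_0\in D$. If the trajectory leaves $D$ at some time, it stays from then on in an additional absorbing state $\dagger$ with output $y^\dagger\notin Y$. Thus the system is a deterministic, non-blocking transition system $\mathcal S$ with state set $D^\dagger=D\cup\{\dagger\}$, one-step map $\hat f:D^\dagger\to D^\dagger$, output map $\hat h:D^\dagger\to Y^\dagger=Y\cup\{y^\dagger\}$ and initial states $D$. (If $f(D)\subseteq D$, the state $\dagger$ and the symbol $y^\dagger$ play no role.) Let $x_0$ be drawn from a probability measure $\mathcal P$ on $D$. Let $1\le\ell\le H$, $N\in\mathbb N$ and $\beta\in(0,1)$. Draw $x_{0,1},\dots,x_{0,N}$ i.i.d. from $\mathcal P$ and record the output trajectories $y_0y_1\cdots y_{H-1}$ of length $H$ from these initial states. Let $\mathcal X_\ell^N\subseteq (Y^\dagger)^\ell$ be the set of all $\ell$-sequences that occur as blocks of $\ell$ consecutive entries in these trajectories. The data-driven $\ell$-complete abstraction $\mathcal S_\ell^N$ is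 the transition system with state set $\mathcal X_\ell^N$, all states initial, transitions $k\sigma\to\sigma k'$ (for $k,k'\in Y^\dagger$, $\sigma\in(Y^\dagger)^{\ell-1}$ and $k\sigma,\sigma k'\in\mathcal X_\ell^N$), and output $k$ at the state $k\sigma$. Let $\delta_i\in\{0,1\}^{(Y^\dagger)^\ell}$ be the vector that marks the $\ell$-sequences occurring in the $i$-th trajectory. The scenario program is $$\min_{\theta\in\mathbb R^{(Y^\dagger)^\ell}}\ \sum_j\theta_j\quad\text{subject to}\quad \theta\ge\delta_i,\quad i=1,\dots,N,$$ and its complexity $s^*$ is the smallest $m$ such that some $m$ of the $N$ constraints give the same solution as all $N$ of them. The scenario bound is $\bar\epsilon=\epsilon(s^*,N,\beta)$, where $\epsilon(N,N,\beta)=1$ and, for $0\le k<N$, $\epsilon(k,N,\beta)=1-t$ with $t$ the unique root in $(0,1)$ of $$\binom Nk t^{N-k}-\frac{\beta}{N}\sum_{i=k}^{N-1}\binom ik t^{i-k}=0.$$ For $w=w_1\cdots w_\ell\in(Y^\dagger)^\ell$ let $[w]=\{x\in D^\dagger:\hat h(\hat f^{\,j-1}(x))=w_j,\ j=1,\dots,\ell\}$.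 For $S\subseteq D^\dagger$ and $0\le k\le\infty$ let $$\mu_0^k(S)=\mathcal P\{x\in D:\hat f^{\,i}(x)\in S\text{ for some finite } i \text{ with } 0\le i\le k\}.$$ Let $\varphi:\mathbb N\to\mathbb R$ be nondecreasing with $\varphi(H-\ell)>0$, and suppose that $$\mu_0^{H-\ell}(S)\ \ge\ \varphi(H-\ell)\,\mu_0^\infty(S)\qquad\text{for every union } S=\bigcup_{w\in J}[w],\ J\subseteq (Y^\dagger)^\ell .$$ Put $\bar\gamma=\bar\epsilon/\varphi(H-\ell)$. Then $$\mathcal P^N\Big[\ \mathcal P\big[x_0:\ \mathcal B^\omega(\mathcal S(x_0))\subseteq\mathcal B^\omega(\mathcal S_\ell^N)\big]\ \ge\ 1-\bar\gamma\ \Big]\ \ge\ 1-\beta ,$$ where $\mathcal B^\omega(\mathcal S(x_0))$ is the set of infinite output behaviours of $\mathcal S$ started at $x_0$ (it consists of one sequence) and $\mathcal B^\omega(\mathcal S_\ell^N)$ is the set of infinite output behaviours of $\mathcal S_\ell^N$. -/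

import Mathlib

open MeasureTheory Set

/-! ### Transition systems and behavioural inclusion -/

/-- A transition system with states `X` and outputs `O`. -/
structure TransitionSystem (X O : Type*) where
  init : Set X
  edge : X → X → Prop
  out : X → O

namespace TransitionSystem

variable {X X' O : Type*}

/-- Infinite internal behaviours. -/
def IsRun (S : TransitionSystem X O) (r : ℕ → X) : Prop :=
  r 0 ∈ S.init ∧ ∀ i, S.edge (r i) (r (i + 1))

/-- The set of infinite external behaviours `𝓑^ω(S)`. -/
def infBehaviours (S : TransitionSystem X O) : Set (ℕ → O) :=
  {y | ∃ r, S.IsRun r ∧ ∀ i, S.out (r i) = y i}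

/-- The system `S(x)`: the same system, started from the state `x`. -/
def startingAt (S : TransitionSystem X O) (x : X) : TransitionSystem X O where
  init := {x}
  edge := S.edge
  out := S.out

/-- `Sb` behaviourally includes `Sa`. -/
def BehaviourallyIncludedIn (Sa : TransitionSystem X O) (Sb : TransitionSystem X' O) : Prop :=
  Sa.infBehaviours ⊆ Sb.infBehaviours

end TransitionSystem

/-! ### The concrete system -/

/-- A deterministic system `x⁺ = f x`, `y = h x` on a measurable domain `D ⊆ ℝⁿ`, with outputs
in `Y`. The map `f` may leave `D`. -/
structure OutputSystem (n : ℕ) (Y : Type*) where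
  D : Set (EuclideanSpace ℝ (Fin n))
  measurableSet_D : MeasurableSet D
  f : D → EuclideanSpace ℝ (Fin n)
  measurable_f : Measurable f
  h : D → Y
  measurable_h : ∀ y, MeasurableSet (h ⁻¹' {y})

namespace OutputSystem

variable {n : ℕ} {Y : Type*} (Sys : OutputSystem n Y)

/-- The states of the system: points of `D`, or `none` once the trajectory has left `D`. -/
abbrev State : Type := Option Sys.D

open Classical in
/-- One step of the dynamics: `f`, as long as it stays in `D`; after leaving `D` the trajectory
remains in `none`. -/
noncomputable def step : Sys.State → Sys.State
  | none => none
  | some x => if hx : Sys.f x ∈ Sys.D then some ⟨Sys.f x, hx⟩ else none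

/-- The output; `none : Option Y` is the special symbol returned once the trajectory has left `D`. -/
def output : Sys.State → Option Y := Option.map Sys.h

/-- The embedding of the system as a transition system. -/
noncomputable def embedding : TransitionSystem Sys.State (Option Y) where
  init := range some
  edge x x' := x' = Sys.step x
  out := Sys.output

/-- The output sequence of length `H` generated from the initial state `x`. -/
noncomputable def trajectory (H : ℕ) (x : Sys.D) : Fin H → Option Y :=
  fun t => Sys.output (Sys.step^[t] (some x))

/-- The equivalence class `[w]` of an output sequence `w` of length `ℓ`. -/
def eqClass {ℓ : ℕ} (w : Fin ℓ → Option Y) : Set Sys.State :=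
  {x | ∀ j : Fin ℓ, w j = Sys.output (Sys.step^[j] x)}

/-- `Pre^i(S)`: the initial states in `D` that are in `S` after `i` steps. If `S` does not contain
`none`, their trajectories are in `D` at all times `j ≤ i`, since `none` is never left. -/
def pre (i : ℕ) (S : Set Sys.State) : Set Sys.D :=
  {x | Sys.step^[i] (some x) ∈ S}

/-- `μ_0^k(S)`. -/
noncomputable def hitWithin (P : Measure Sys.D) (k : ℕ) (S : Set Sys.State) : ℝ :=
  P.real (⋃ i ∈ Iic k, Sys.pre i S)

/-- `μ_0^∞(S)`. -/
noncomputable def hitEver (P : Measure Sys.D) (S : Set Sys.State) : ℝ :=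
  P.real (⋃ i, Sys.pre i S)

/-- `φ` is monotone and `μ_0^k(S) ≥ φ(k) μ_0^∞(S)` for all unions `S` of equivalence classes of
`ℓ`-sequences. -/
def MeasureAttractive (P : Measure Sys.D) (ℓ : ℕ) (φ : ℕ → ℝ) (k : ℕ) : Prop :=
  Monotone φ ∧ ∀ J : Set (Fin ℓ → Option Y),
    φ k * Sys.hitEver P (⋃ w ∈ J, Sys.eqClass w) ≤ Sys.hitWithin P k (⋃ w ∈ J, Sys.eqClass w)

end OutputSystem

/-! ### The data-driven `ℓ`-complete abstraction -/

/-- The finite sequence `r` exhibits `p` as a block of consecutive entries. -/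
def Exhibits {O : Type*} {H ℓ : ℕ} (r : Fin H → O) (p : Fin ℓ → O) : Prop :=
  ∃ k : ℕ, ∃ hk : k + ℓ ≤ H, ∀ i : Fin ℓ, r ⟨k + i, by omega⟩ = p i

/-- The transition system with state set `W`, a set of `ℓ`-sequences, all of them initial, with the
domino transitions `kσ → σk'`, and with output the first letter. -/
def dominoSystem {O : Type*} {ℓ : ℕ} (hℓ : 0 < ℓ) (W : Set (Fin ℓ → O)) :
    TransitionSystem W O where
  init := univ
  edge w w' := ∀ i j : Fin ℓ, (j : ℕ) = i + 1 → w.1 j = w'.1 i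
  out w := w.1 ⟨0, hℓ⟩

namespace OutputSystem

variable {n : ℕ} {Y : Type*} (Sys : OutputSystem n Y)

/-- The `ℓ`-sequences witnessed in the trajectories of length `H` from the initial states `ω i`. -/
def witnessed {N : ℕ} (H ℓ : ℕ) (ω : Fin N → Sys.D) : Set (Fin ℓ → Option Y) :=
  {w | ∃ i, Exhibits (Sys.trajectory H (ω i)) w}

/-- The data-driven `ℓ`-complete abstraction built from the trajectories of length `H` from the
initial states `ω i`. -/
def dataDriven {N : ℕ} (H : ℕ) {ℓ : ℕ} (hℓ : 0 < ℓ) (ω : Fin N → Sys.D) :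
    TransitionSystem (Sys.witnessed H ℓ ω) (Option Y) :=
  dominoSystem hℓ (Sys.witnessed H ℓ ω)

/-- The scenario `δ` generated by the initial state `x`: the 0-1 vector indexed by all
`ℓ`-sequences that marks those exhibited by the trajectory of length `H` from `x`. -/
noncomputable def scenario (H ℓ : ℕ) (x : Sys.D) : (Fin ℓ → Option Y) → ℝ :=
  indicator {w | Exhibits (Sys.trajectory H x) w} 1

end OutputSystem

/-! ### The scenario program, its complexity, and the scenario bound -/

/-- `θ` solves the scenario program `min ∑ j, θ j` subject to `θ ≥ δ i` for all `i ∈ I`. -/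
def IsScenarioSolution {ι κ : Type*} [Fintype κ] (δ : ι → κ → ℝ) (I : Finset ι) (θ : κ → ℝ) :
    Prop :=
  (∀ i ∈ I, δ i ≤ θ) ∧ ∀ θ' : κ → ℝ, (∀ i ∈ I, δ i ≤ θ') → ∑ j, θ j ≤ ∑ j, θ' j

/-- The complexity `s*`: the least number of the `N` scenarios for which the scenario program has
the same solution as for all of them. -/
noncomputable def complexity {κ : Type*} [Fintype κ] {N : ℕ} (δ : Fin N → κ → ℝ) : ℕ :=
  sInf {m | ∃ I : Finset (Fin N), I.card = m ∧
    ∃ θ, IsScenarioSolution δ I θ ∧ IsScenarioSolution δ Finset.univ θ}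

/-- The polynomial whose root in `(0, 1)` determines the scenario bound. -/
noncomputable def scenarioPoly (k N : ℕ) (β t : ℝ) : ℝ :=
  (N.choose k : ℝ) * t ^ (N - k) -
    β / N * ∑ i ∈ Finset.Ico k N, (i.choose k : ℝ) * t ^ (i - k)

/-- The scenario bound `ε(k, N, β)`: it is `1 - t` for the root `t ∈ (0, 1)` of the polynomial
above if `k < N`, and `1` if `k = N`. For `0 < β < 1` the root exists and is unique, see
`existsUnique_scenarioPoly_root`. -/
noncomputable def scenarioBound (k N : ℕ) (β : ℝ) : ℝ :=
  if k < N then 1 - sSup {t : ℝ | t ∈ Ioo 0 1 ∧ scenarioPoly k N β t = 0} else 1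

theorem existsUnique_scenarioPoly_root {k N : ℕ} (hk : k < N) {β : ℝ} (h0 : 0 < β) (h1 : β < 1) :
    ∃! t : ℝ, t ∈ Ioo (0 : ℝ) 1 ∧ scenarioPoly k N β t = 0 := by
  have hN : (0 : ℝ) < N := by exact_mod_cast (Nat.zero_le k).trans_lt hk
  have hc : (0 : ℝ) < N.choose k := by exact_mod_cast Nat.choose_pos hk.le
  have hval0 : scenarioPoly k N β 0 < 0 := by
    have : ∑ i ∈ Finset.Ico k N, (i.choose k : ℝ) * (0 : ℝ) ^ (i - k) = 1 := by
      rw [Finset.sum_eq_single_of_mem k (by simp [hk])]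
      · simp
      · intro i hi hik
        have : i - k ≠ 0 := by
          have := (Finset.mem_Ico.1 hi).1
          omega
        simp [this]
    have hz : N - k ≠ 0 := by omega
    simp only [scenarioPoly, this]
    simp only [ne_eq, hz, not_false_eq_true, zero_pow, mul_zero, mul_one, zero_sub,
      Left.neg_neg_iff]
    positivity
  have hval1 : 0 < scenarioPoly k N β 1 := by
    have hle : ∑ i ∈ Finset.Ico k N, (i.choose k : ℝ) * (1 : ℝ) ^ (i - k) ≤ N * N.choose k := by
      calc _ ≤ ∑ i ∈ Finset.Ico k N, (N.choose k : ℝ) := by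
            refine Finset.sum_le_sum fun i hi => ?_
            simp only [one_pow, mul_one]
            exact_mod_cast Nat.choose_le_choose k (Finset.mem_Ico.1 hi).2.le
        _ = ((N - k : ℕ) : ℝ) * N.choose k := by simp
        _ ≤ N * N.choose k := by
            gcongr
            exact Nat.sub_le N k
    have h2 : β / N * ∑ i ∈ Finset.Ico k N, (i.choose k : ℝ) * (1 : ℝ) ^ (i - k)
        ≤ β * N.choose k := by
      calc _ ≤ β / N * (N * N.choose k) := by gcongr
        _ = β * N.choose k := by field_simp
    have h3 : β * N.choose k < N.choose k := by nlinarith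
    simp only [scenarioPoly, one_pow, mul_one] at h2 ⊢
    linarith
  have hcont : Continuous (scenarioPoly k N β) := by
    unfold scenarioPoly
    fun_prop
  obtain ⟨t, ht, ht0⟩ := intermediate_value_Ioo (zero_le_one (α := ℝ)) hcont.continuousOn
    (show (0 : ℝ) ∈ Ioo _ _ from ⟨hval0, hval1⟩)
  have key : ∀ s t : ℝ, 0 < s → s < t → scenarioPoly k N β s = 0 → scenarioPoly k N β t ≠ 0 := by
    intro s t hs hst hs0 ht0
    have ht : 0 < t := hs.trans hst
    have e : ∀ u : ℝ, scenarioPoly k N β u = 0 →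
        (N.choose k : ℝ) * u ^ (N - k) =
          β / N * ∑ i ∈ Finset.Ico k N, (i.choose k : ℝ) * u ^ (i - k) := by
      intro u hu
      unfold scenarioPoly at hu
      linarith
    have es := e s hs0
    have et := e t ht0
    have hlt : s ^ (N - k) * ∑ i ∈ Finset.Ico k N, (i.choose k : ℝ) * t ^ (i - k)
        < t ^ (N - k) * ∑ i ∈ Finset.Ico k N, (i.choose k : ℝ) * s ^ (i - k) := by
      rw [Finset.mul_sum, Finset.mul_sum]
      refine Finset.sum_lt_sum_of_nonempty (Finset.nonempty_Ico.2 hk) fun i hi => ?_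
      obtain ⟨hki, hiN⟩ := Finset.mem_Ico.1 hi
      have hci : (0 : ℝ) < i.choose k := by exact_mod_cast Nat.choose_pos hki
      have hsplit : N - k = (i - k) + (N - i) := by omega
      have hp : s ^ (N - i) < t ^ (N - i) := pow_lt_pow_left₀ hst hs.le (by omega)
      rw [hsplit, pow_add, pow_add]
      have hm : 0 < (i.choose k : ℝ) * (s ^ (i - k) * t ^ (i - k)) := by positivity
      nlinarith [mul_lt_mul_of_pos_left hp hm]
    have hb : 0 < β / N := by positivity
    have h3 := mul_lt_mul_of_pos_left hlt hb
    rw [mul_left_comm, mul_left_comm (β / N), ← es, ← et] at h3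
    exact absurd h3 (by rw [not_lt]; exact le_of_eq (by ring))
  refine ⟨t, ⟨ht, ht0⟩, fun s hs => ?_⟩
  rcases lt_trichotomy s t with h | h | h
  · exact absurd ht0 (key s t hs.1.1 h hs.2)
  · exact h
  · exact absurd hs.2 (key t s ht.1 h ht0)

/-! The sets of blocks shown by the `N` sampled trajectories are independent copies of a random
element of a finite semilattice, and the scenario program computes their supremum `W`. Its
complexity is the size `k` of a smallest subfamily `I` with the same supremum; a fixed ranking
breaks ties, so `I` is unique. Let `s` be the mass of the elements below the supremum over `I`; the
risk is `1 - s`.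

If `I` is selected from all samples, it is selected from every `M ⊇ I`, and all samples outside `M`
lie below the supremum over `I`. Since `s` depends only on the samples in `I`, independence gives,
for `|M| = m` and up to the null event `s = 0`, `E[s^(-(N-m)); I selected from all] ≤ P[I selected
from M]` (`piExp_selInd_union_le`). Averaging over all `M` of size `m` and summing over `I` yields
`∑_I C(m,k)/C(N,k) E[s^(-(N-m)); I selected from all] ≤ 1`, because each `M` selects exactly one
`I`. A risk above `ε(k, N, β)` makes the scenario polynomial nonpositive at `s`, that is, `1 ≤ β/N
∑_{m<N} C(m,k)/C(N,k) s^(-(N-m))` when `s > 0`. Taking expectations bounds the bad event by `β`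
(`piExp_bad_le`).

A trajectory whose behaviour the abstraction misses must enter some `[w]` with `w ∉ W`. Doing so by
time `H - ℓ` has probability equal to the risk, and attractivity bounds the probability of ever
doing so by the risk over `φ (H - ℓ)` (`one_sub_div_le_measureReal_included`). -/

/-! ### Finite product distributions -/

section ProductWeights

variable {ι A : Type*} [Fintype ι] [Fintype A]

/-- The expectation of `F` when the coordinates are drawn independently with the weights `q`. -/
noncomputable def piExp (q : A → ℝ) (F : (ι → A) → ℝ) : ℝ :=
  open Classical in ∑ ω : ι → A, (∏ i, q (ω i)) * F ω

theorem piExp_eq_sum [DecidableEq ι] (q : A → ℝ) (F : (ι → A) → ℝ) :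
    piExp q F = ∑ ω : ι → A, (∏ i, q (ω i)) * F ω := by
  unfold piExp
  congr!

theorem piExp_mono {q : A → ℝ} (hq : ∀ a, 0 ≤ q a) {F G : (ι → A) → ℝ} (h : ∀ ω, F ω ≤ G ω) :
    piExp q F ≤ piExp q G :=
  Finset.sum_le_sum fun ω _ =>
    mul_le_mul_of_nonneg_left (h ω) (Finset.prod_nonneg fun i _ => hq (ω i))

theorem piExp_nonneg {q : A → ℝ} (hq : ∀ a, 0 ≤ q a) {F : (ι → A) → ℝ} (h : ∀ ω, 0 ≤ F ω) :
    0 ≤ piExp q F :=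
  Finset.sum_nonneg fun ω _ => mul_nonneg (Finset.prod_nonneg fun i _ => hq (ω i)) (h ω)

theorem piExp_sum {κ : Type*} (q : A → ℝ) (s : Finset κ) (F : κ → (ι → A) → ℝ) :
    piExp q (fun ω => ∑ j ∈ s, F j ω) = ∑ j ∈ s, piExp q (F j) := by
  simp only [piExp, Finset.mul_sum]
  rw [Finset.sum_comm]

theorem piExp_const_mul (q : A → ℝ) (c : ℝ) (F : (ι → A) → ℝ) :
    piExp q (fun ω => c * F ω) = c * piExp q F := by
  simp only [piExp, Finset.mul_sum]
  exact Finset.sum_congr rfl fun ω _ => by ring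

theorem piExp_add (q : A → ℝ) (F G : (ι → A) → ℝ) :
    piExp q (fun ω => F ω + G ω) = piExp q F + piExp q G := by
  simp only [piExp, mul_add, Finset.sum_add_distrib]

theorem piExp_one {q : A → ℝ} (h1 : ∑ a, q a = 1) : piExp (ι := ι) q (fun _ => 1) = 1 := by
  classical
  simp only [piExp_eq_sum, mul_one]
  rw [← Fintype.piFinset_univ, ← Finset.prod_univ_sum (fun _ => Finset.univ) (fun _ a => q a)]
  simp [h1]

/-- Resampling one coordinate does not change the expectation. -/
theorem piExp_update [DecidableEq ι] {q : A → ℝ} (h1 : ∑ a, q a = 1) (j : ι)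
    (F : (ι → A) → ℝ) :
    piExp q (fun ω => ∑ a, q a * F (Function.update ω j a)) = piExp q F := by
  classical
  have hw : ∀ (ω : ι → A) (a : A), (∏ i, q (Function.update ω j a i)) * q (ω j)
      = (∏ i, q (ω i)) * q a := by
    intro ω a
    rw [← Finset.mul_prod_erase _ _ (Finset.mem_univ j),
      ← Finset.mul_prod_erase _ (fun i => q (ω i)) (Finset.mem_univ j)]
    have : ∏ i ∈ Finset.univ.erase j, q (Function.update ω j a i)
        = ∏ i ∈ Finset.univ.erase j, q (ω i) :=
      Finset.prod_congr rfl fun i hi => by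
        rw [Function.update_of_ne (Finset.ne_of_mem_erase hi)]
    rw [this, Function.update_self]
    ring
  calc piExp q (fun ω => ∑ a, q a * F (Function.update ω j a))
      = ∑ p : (ι → A) × A, (∏ i, q (p.1 i)) * q p.2 * F (Function.update p.1 j p.2) := by
        simp only [piExp_eq_sum, Finset.mul_sum, Fintype.sum_prod_type, mul_assoc]
    _ = ∑ p : (ι → A) × A, (∏ i, q (p.1 i)) * q p.2 * F p.1 := by
        -- Exchanging `ω j` with the fresh value `a` is an involution on the pairs `(ω, a)`, and it
        -- preserves the weight by `hw`.
        refine Finset.sum_nbij' (fun p => (Function.update p.1 j p.2, p.1 j))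
          (fun p => (Function.update p.1 j p.2, p.1 j)) (by simp) (by simp) (by simp) (by simp) ?_
        rintro ⟨ω, a⟩ -
        simp only [hw]
    _ = piExp q F := by
        simp only [piExp_eq_sum, Fintype.sum_prod_type]
        refine Finset.sum_congr rfl fun ω _ => ?_
        rw [← Finset.sum_mul, ← Finset.mul_sum, h1, mul_one]

end ProductWeights

/-! ### Minimal subfamilies with the same supremum -/

section Selection

variable {ι A : Type*} [SemilatticeSup A] [OrderBot A]

theorem sup_update_of_notMem [DecidableEq ι] {I : Finset ι} {j : ι} (hj : j ∉ I) (ω : ι → A)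
    (a : A) : I.sup (Function.update ω j a) = I.sup ω :=
  Finset.sup_congr rfl fun i hi => by
    rw [Function.update_of_ne (ne_of_mem_of_not_mem hi hj)]

variable [Fintype ι]

/-- An injective ranking of the finite subsets of `ι` that compares cardinalities first. -/
noncomputable def finsetRank (I : Finset ι) : ℕ ×ₗ Fin (Fintype.card (Finset ι)) :=
  toLex (I.card, Fintype.equivFin (Finset ι) I)

theorem finsetRank_injective : Function.Injective (finsetRank (ι := ι)) := by
  intro I J h
  have := congrArg (fun p => (ofLex p).2) h
  exact (Fintype.equivFin (Finset ι)).injective this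

theorem card_le_of_finsetRank_le {I J : Finset ι} (h : finsetRank I ≤ finsetRank J) :
    I.card ≤ J.card := by
  rcases Prod.Lex.toLex_le_toLex.1 h with h | h
  · exact h.le
  · exact h.1.le

/-- `I` is the first subset of `M` over which `ω` has the same supremum as over `M`. -/
def IsSelected (M : Finset ι) (ω : ι → A) (I : Finset ι) : Prop :=
  I ⊆ M ∧ I.sup ω = M.sup ω ∧ ∀ J ⊆ M, J.sup ω = M.sup ω → finsetRank I ≤ finsetRank J

theorem existsUnique_isSelected (M : Finset ι) (ω : ι → A) : ∃! I, IsSelected M ω I := by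
  classical
  obtain ⟨I, hI, hmin⟩ := Finset.exists_min_image (M.powerset.filter fun I => I.sup ω = M.sup ω)
    finsetRank ⟨M, by simp⟩
  simp only [Finset.mem_filter, Finset.mem_powerset] at hI hmin
  refine ⟨I, ⟨hI.1, hI.2, fun J h1 h2 => hmin J ⟨h1, h2⟩⟩, fun J hJ => ?_⟩
  exact finsetRank_injective (le_antisymm (hJ.2.2 I hI.1 hI.2) (hmin J ⟨hJ.1, hJ.2.1⟩))

/-- The supremum over `M` is squeezed between those over `I` and `M'`, so every competitor of `I`
inside `M` already competes inside `M'`. -/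
theorem IsSelected.mono {M M' I : Finset ι} {ω : ι → A} (h : IsSelected M' ω I) (hI : I ⊆ M)
    (hM : M ⊆ M') : IsSelected M ω I := by
  have e : M.sup ω = M'.sup ω :=
    le_antisymm (Finset.sup_mono hM) (h.2.1 ▸ Finset.sup_mono hI)
  exact ⟨hI, h.2.1.trans e.symm, fun J hJ hs => h.2.2 J (hJ.trans hM) (hs.trans e)⟩

theorem IsSelected.le_sup {M I : Finset ι} {ω : ι → A} (h : IsSelected M ω I) {j : ι}
    (hj : j ∈ M) : ω j ≤ I.sup ω :=
  h.2.1 ▸ Finset.le_sup (f := ω) hj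

theorem isSelected_update_iff [DecidableEq ι] {M I : Finset ι} {j : ι} (hj : j ∉ M)
    (ω : ι → A) (a : A) : IsSelected M (Function.update ω j a) I ↔ IsSelected M ω I := by
  have h : ∀ J ⊆ M, J.sup (Function.update ω j a) = J.sup ω := fun J hJ =>
    sup_update_of_notMem (fun h => hj (hJ h)) ω a
  unfold IsSelected
  constructor
  · rintro ⟨h1, h2, h3⟩
    rw [h _ h1, h M subset_rfl] at h2
    exact ⟨h1, h2, fun J hJ e => h3 J hJ (by rw [h _ hJ, h M subset_rfl, e])⟩
  · rintro ⟨h1, h2, h3⟩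
    refine ⟨h1, by rw [h _ h1, h M subset_rfl, h2], fun J hJ e => h3 J hJ ?_⟩
    rwa [h _ hJ, h M subset_rfl] at e

open Classical in
/-- The indicator of the event that `I` is selected from `M`. -/
noncomputable def selInd (M I : Finset ι) (ω : ι → A) : ℝ := if IsSelected M ω I then 1 else 0

theorem selInd_nonneg (M I : Finset ι) (ω : ι → A) : 0 ≤ selInd M I ω := by
  unfold selInd; split_ifs <;> simp

theorem sum_selInd (M : Finset ι) (ω : ι → A) : ∑ I, selInd M I ω = 1 := by
  obtain ⟨I, hI, hu⟩ := existsUnique_isSelected M ω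
  rw [Finset.sum_eq_single I]
  · simp [selInd, hI]
  · intro J _ hJ
    exact if_neg fun h => hJ (hu J h)
  · simp

end Selection

/-! ### The risk of the selected subfamily -/

open Classical in
/-- The mass of the elements below `b`. -/
noncomputable def massBelow {A : Type*} [Fintype A] [LE A] (q : A → ℝ) (b : A) : ℝ := ∑ a, if a ≤ b then q a else 0

theorem massBelow_nonneg {A : Type*} [Fintype A] [LE A] {q : A → ℝ} (hq : ∀ a, 0 ≤ q a) (b : A) : 0 ≤ massBelow q b :=
  Finset.sum_nonneg fun a _ => by split_ifs <;> simp [hq]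

section Risk

variable {ι A : Type*} [Fintype ι] [Fintype A] [SemilatticeSup A] [OrderBot A]

/-- Resample coordinate `j`. Selection of `I` from `insert j M` forces selection from `M`, which
ignores `j`, and a value at `j` below `I.sup ω`; given the other coordinates, the latter has
probability `massBelow q (I.sup ω)`. -/
theorem piExp_selInd_insert_le [DecidableEq ι] {q : A → ℝ} (hq : ∀ a, 0 ≤ q a)
    (h1 : ∑ a, q a = 1) {M I : Finset ι} (hI : I ⊆ M) {j : ι} (hj : j ∉ M) {g : (ι → A) → ℝ}
    (hg : ∀ ω, 0 ≤ g ω) (hgj : ∀ ω a, g (Function.update ω j a) = g ω) :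
    piExp q (fun ω => g ω * selInd (insert j M) I ω) ≤
      piExp q (fun ω => g ω * massBelow q (I.sup ω) * selInd M I ω) := by
  rw [← piExp_update h1 j (fun ω => g ω * selInd (insert j M) I ω)]
  refine piExp_mono hq fun ω => ?_
  rw [massBelow, Finset.mul_sum, Finset.sum_mul]
  refine Finset.sum_le_sum fun a _ => ?_
  rw [hgj]
  by_cases h : IsSelected (insert j M) (Function.update ω j a) I
  · have h2 : IsSelected M ω I :=
      (isSelected_update_iff hj ω a).1 (h.mono hI (Finset.subset_insert j M))
    have h3 : a ≤ I.sup ω := by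
      have := h.le_sup (Finset.mem_insert_self j M)
      rwa [Function.update_self, sup_update_of_notMem (fun h => hj (hI h))] at this
    simp [selInd, h, h2, h3, mul_comm]
  · rw [selInd, if_neg h, mul_zero, mul_zero]
    refine mul_nonneg (mul_nonneg (hg ω) ?_) (selInd_nonneg M I ω)
    split_ifs <;> simp [hq]

/-- The coordinates of `T` are removed one by one. The weight `g` is general so that it can absorb
the factor `massBelow q (I.sup ω)` produced each time, which again depends only on the coordinates
in `I`. -/
theorem piExp_selInd_union_le [DecidableEq ι] {q : A → ℝ} (hq : ∀ a, 0 ≤ q a)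
    (h1 : ∑ a, q a = 1) {M I : Finset ι} (hI : I ⊆ M) (T : Finset ι) (hT : Disjoint M T)
    {g : (ι → A) → ℝ} (hg : ∀ ω, 0 ≤ g ω)
    (hgj : ∀ j ∉ I, ∀ ω a, g (Function.update ω j a) = g ω) :
    piExp q (fun ω => g ω * selInd (M ∪ T) I ω) ≤
      piExp q (fun ω => g ω * massBelow q (I.sup ω) ^ T.card * selInd M I ω) := by
  induction T using Finset.induction_on generalizing g with
  | empty => simp
  | insert j T hjT ih =>
    rw [Finset.disjoint_insert_right] at hT
    have hjM : j ∉ M ∪ T := by simp [hT.1, hjT]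
    have hjI : j ∉ I := fun h => hT.1 (hI h)
    rw [Finset.union_insert]
    refine (piExp_selInd_insert_le hq h1 (hI.trans Finset.subset_union_left) hjM hg
      (hgj j hjI)).trans ((ih hT.2 (fun ω => mul_nonneg (hg ω) (massBelow_nonneg hq _)) ?_).trans
      (le_of_eq ?_))
    · intro i hi ω a
      rw [hgj i hi, sup_update_of_notMem hi]
    · rw [Finset.card_insert_of_notMem hjT]
      congr 1
      ext ω
      ring

theorem card_filter_superset_powersetCard (I : Finset ι) {m : ℕ} (hm : I.card ≤ m) :
    (open Classical in ((Finset.univ : Finset ι).powersetCard m).filter (I ⊆ ·)).card =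
      (Fintype.card ι - I.card).choose (m - I.card) := by
  classical
  rw [← Finset.card_compl, ← Finset.card_powersetCard]
  refine Finset.card_nbij' (· \ I) (I ∪ ·) ?_ ?_ ?_ ?_
  · intro M hM
    simp only [Finset.coe_filter, Finset.mem_powersetCard, mem_ofPred_eq] at hM
    simp only [Finset.mem_coe, Finset.mem_powersetCard]
    refine ⟨fun x hx => ?_, ?_⟩
    · simp only [Finset.mem_sdiff] at hx
      simpa using hx.2
    · rw [Finset.card_sdiff_of_subset hM.2, hM.1.2]
  · intro T hT
    simp only [Finset.mem_coe, Finset.mem_powersetCard] at hT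
    have hd : Disjoint I T := (Finset.subset_compl_iff_disjoint_left.1 hT.1)
    simp only [Finset.coe_filter, Finset.mem_powersetCard, mem_ofPred_eq]
    refine ⟨⟨Finset.subset_univ _, ?_⟩, Finset.subset_union_left⟩
    rw [Finset.card_union_of_disjoint hd, hT.2]
    omega
  · intro M hM
    simp only [Finset.coe_filter, mem_ofPred_eq] at hM
    exact Finset.union_sdiff_of_subset hM.2
  · intro T hT
    simp only [Finset.mem_coe, Finset.mem_powersetCard] at hT
    exact Finset.union_sdiff_cancel_left (Finset.subset_compl_iff_disjoint_left.1 hT.1)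

/-- A bound for the probability that `I` is selected and the mass below its supremum is in a set
on which the scenario polynomial is not positive, by the average probability that `I` is selected
from a proper subfamily. -/
theorem piExp_selInd_univ_le {q : A → ℝ} (hq : ∀ a, 0 ≤ q a) (h1 : ∑ a, q a = 1)
    (I : Finset ι) (hI : I.card < Fintype.card ι) {β : ℝ} (hβ : 0 ≤ β) {B : Set ℝ}
    (hB : ∀ s ∈ B, 0 < s → scenarioPoly I.card (Fintype.card ι) β s ≤ 0) :
    piExp q (fun ω => B.indicator 1 (massBelow q (I.sup ω)) * selInd Finset.univ I ω) ≤
      β / Fintype.card ι * ∑ m ∈ Finset.range (Fintype.card ι),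
        ((Fintype.card ι).choose m : ℝ)⁻¹ *
          ∑ M ∈ (Finset.univ : Finset ι).powersetCard m, piExp q (selInd M I) := by
  classical
  set N := Fintype.card ι with hN
  set k := I.card with hk
  set s : (ι → A) → ℝ := fun ω => massBelow q (I.sup ω) with hs
  have hs0 : ∀ ω, 0 ≤ s ω := fun ω => massBelow_nonneg hq _
  have hsj : ∀ j ∉ I, ∀ ω a, s (Function.update ω j a) = s ω := fun j hj ω a => by
    simp only [hs, sup_update_of_notMem hj]
  have hc : (0 : ℝ) < N.choose k := by exact_mod_cast Nat.choose_pos hI.le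
  have reduce : ∀ (M : Finset ι), I ⊆ M → ∀ u : ℝ → ℝ, (∀ x, 0 ≤ x → 0 ≤ u x) →
      piExp q (fun ω => u (s ω) * selInd Finset.univ I ω) ≤
        piExp q (fun ω => u (s ω) * s ω ^ (N - M.card) * selInd M I ω) := by
    intro M hM u hu
    have := piExp_selInd_union_le hq h1 hM Mᶜ disjoint_compl_right
      (g := fun ω => u (s ω)) (fun ω => hu _ (hs0 ω)) (fun j hj ω a => by rw [hsj j hj])
    rwa [Finset.union_compl, Finset.card_compl] at this
  -- The value `s = 0` must be split off before dividing by powers of `s`. It is null: with `M = I`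
  -- the bound carries the factor `s ^ (N - k)`, whose exponent is positive.
  have hzero : piExp q (fun ω => (({0} : Set ℝ).indicator 1 (s ω)) * selInd Finset.univ I ω) ≤
      0 := by
    refine (reduce I subset_rfl (({0} : Set ℝ).indicator 1)
      (fun x _ => indicator_nonneg (fun _ _ => zero_le_one) x)).trans ?_
    have : ∀ ω, (({0} : Set ℝ).indicator (1 : ℝ → ℝ) (s ω)) * s ω ^ (N - I.card) *
        selInd I I ω = 0 := by
      intro ω
      by_cases h : s ω = 0
      · have : N - I.card ≠ 0 := by omega
        simp [h, this]
      · simp [h]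
    rw [piExp, Finset.sum_eq_zero fun ω _ => by rw [this, mul_zero]]
  -- This weight cancels the factor `s ^ (N - m)` in `reduce`, leaving at most the indicator of
  -- selection from `M`.
  let u : ℕ → ℝ → ℝ := fun m x => if 0 < x then (x ^ (N - m))⁻¹ else 0
  have hu : ∀ m x, 0 ≤ x → 0 ≤ u m x := fun m x hx => by
    simp only [u]; split_ifs <;> positivity
  -- Sum `reduce` over the `C(N-k, m-k)` sets `M ⊇ I` of size `m`, and drop the condition `M ⊇ I` on
  -- the right. For `m < k` the coefficient `C(m, k)` vanishes.
  have hterm : ∀ m ∈ Finset.range N, (m.choose k : ℝ) / N.choose k *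
      piExp q (fun ω => u m (s ω) * selInd Finset.univ I ω) ≤ (N.choose m : ℝ)⁻¹ *
        ∑ M ∈ (Finset.univ : Finset ι).powersetCard m, piExp q (selInd M I) := by
    intro m hm
    have hmN : m < N := Finset.mem_range.1 hm
    have hcm : (0 : ℝ) < N.choose m := by exact_mod_cast Nat.choose_pos hmN.le
    have hrhs : 0 ≤ (N.choose m : ℝ)⁻¹ *
        ∑ M ∈ (Finset.univ : Finset ι).powersetCard m, piExp q (selInd M I) :=
      mul_nonneg (inv_nonneg.2 hcm.le)
        (Finset.sum_nonneg fun M _ => piExp_nonneg hq (selInd_nonneg M I))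
    rcases lt_or_ge m k with hmk | hkm
    · rw [Nat.choose_eq_zero_of_lt hmk]
      simpa using hrhs
    · set x := piExp q (fun ω => u m (s ω) * selInd Finset.univ I ω)
      have hx : ((N - k).choose (m - k) : ℝ) * x ≤
          ∑ M ∈ (Finset.univ : Finset ι).powersetCard m, piExp q (selInd M I) := by
        rw [← card_filter_superset_powersetCard I hkm, ← nsmul_eq_mul]
        refine (Finset.card_nsmul_le_sum _ (fun M => piExp q (selInd M I)) x ?_).trans
          (Finset.sum_le_sum_of_subset_of_nonneg (by convert Finset.filter_subset _ _)
            fun M _ _ => piExp_nonneg hq (selInd_nonneg M I))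
        intro M hM
        simp only [Finset.mem_filter, Finset.mem_powersetCard] at hM
        refine (reduce M hM.2 (u m) (hu m)).trans (piExp_mono hq fun ω => ?_)
        refine mul_le_of_le_one_left (selInd_nonneg M I ω) ?_
        rw [hM.1.2]
        by_cases h : 0 < s ω
        · simp only [u, h, if_true]
          rw [inv_mul_cancel₀ (pow_pos h _).ne']
        · simp [u, h]
      have hch : (m.choose k : ℝ) / N.choose k =
          (N.choose m : ℝ)⁻¹ * (N - k).choose (m - k) := by
        have : (N.choose m : ℝ) * m.choose k = N.choose k * (N - k).choose (m - k) := by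
          exact_mod_cast Nat.choose_mul hkm
        field_simp
        linarith
      rw [hch, mul_assoc]
      exact mul_le_mul_of_nonneg_left hx (inv_nonneg.2 hcm.le)
  have hpoint : ∀ ω, B.indicator 1 (s ω) * selInd Finset.univ I ω ≤
      (({0} : Set ℝ).indicator 1 (s ω)) * selInd Finset.univ I ω +
      β / N * ∑ m ∈ Finset.range N, (m.choose k : ℝ) / N.choose k *
        (u m (s ω) * selInd Finset.univ I ω) := by
    intro ω
    have hsel := selInd_nonneg Finset.univ I ω
    have hsum : 0 ≤ β / N * ∑ m ∈ Finset.range N, (m.choose k : ℝ) / N.choose k *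
        (u m (s ω) * selInd Finset.univ I ω) :=
      mul_nonneg (by positivity) (Finset.sum_nonneg fun m _ =>
        mul_nonneg (by positivity) (mul_nonneg (hu m _ (hs0 ω)) hsel))
    by_cases hb : s ω ∈ B
    · rcases (hs0 ω).eq_or_lt with h0 | hpos
      · rw [← h0] at hb hsum ⊢
        simp only [hb, indicator_of_mem, Pi.one_apply, mem_singleton_iff]
        linarith
      · have hp := hB _ hb hpos
        have hne : s ω ∉ ({0} : Set ℝ) := hpos.ne'
        simp only [hb, indicator_of_mem, hne, not_false_eq_true, indicator_of_notMem,
          Pi.one_apply, zero_mul, zero_add]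
        -- This is nonpositivity of the scenario polynomial, divided by `C(N, k) s ^ (N - k)`.
        have : (1 : ℝ) ≤ β / N * ∑ m ∈ Finset.range N, (m.choose k : ℝ) / N.choose k *
            u m (s ω) := by
          have hT : ∑ m ∈ Finset.range N, (m.choose k : ℝ) / N.choose k * u m (s ω) =
              (∑ m ∈ Finset.Ico k N, (m.choose k : ℝ) * s ω ^ (m - k)) /
                (N.choose k * s ω ^ (N - k)) := by
            rw [Finset.sum_div]
            symm
            refine Finset.sum_subset_zero_on_sdiff
              (fun m hm => Finset.mem_range.2 (Finset.mem_Ico.1 hm).2) ?_ ?_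
            · intro m hm
              simp only [Finset.mem_sdiff, Finset.mem_range, Finset.mem_Ico, not_and,
                not_lt] at hm
              have : m < k := by omega
              simp [Nat.choose_eq_zero_of_lt this]
            · intro m hm
              obtain ⟨hkm, hmN⟩ := Finset.mem_Ico.1 hm
              have e : N - k = (m - k) + (N - m) := by omega
              simp only [u, hpos, if_true]
              rw [e, pow_add]
              field_simp
          rw [hT, ← mul_div_assoc, le_div_iff₀ (by positivity), one_mul]
          unfold scenarioPoly at hp
          linarith
        calc 1 * selInd Finset.univ I ω ≤ (β / N * ∑ m ∈ Finset.range N,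
              (m.choose k : ℝ) / N.choose k * u m (s ω)) * selInd Finset.univ I ω :=
              mul_le_mul_of_nonneg_right this hsel
          _ = _ := by
              rw [mul_assoc, Finset.sum_mul]
              simp only [mul_assoc]
    · have : 0 ≤ (({0} : Set ℝ).indicator (1 : ℝ → ℝ) (s ω)) * selInd Finset.univ I ω :=
        mul_nonneg (indicator_nonneg (fun _ _ => zero_le_one) _) hsel
      simp only [hb, not_false_eq_true, indicator_of_notMem, zero_mul]
      linarith
  refine (piExp_mono hq hpoint).trans ?_
  rw [piExp_add, piExp_const_mul, piExp_sum]
  simp only [piExp_const_mul]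
  have := mul_le_mul_of_nonneg_left (Finset.sum_le_sum hterm)
    (show 0 ≤ β / (N : ℝ) by positivity)
  linarith

/-- With probability at least `1 - β`, the mass below the supremum of the sample is outside the
sets `B k` on which the scenario polynomials are not positive, `k` being the size of the selected
subfamily. -/
theorem piExp_bad_le {q : A → ℝ} (hq : ∀ a, 0 ≤ q a) (h1 : ∑ a, q a = 1)
    {β : ℝ} (hβ : 0 ≤ β) {B : ℕ → Set ℝ}
    (hB : ∀ k < Fintype.card ι, ∀ s ∈ B k, 0 < s → scenarioPoly k (Fintype.card ι) β s ≤ 0)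
    (hB' : B (Fintype.card ι) = ∅) :
    piExp q (fun ω : ι → A => ∑ I : Finset ι,
      (B I.card).indicator 1 (massBelow q (I.sup ω)) * selInd Finset.univ I ω) ≤ β := by
  classical
  set N := Fintype.card ι with hN
  rw [piExp_sum]
  have hnn : ∀ I : Finset ι, 0 ≤ β / N * ∑ m ∈ Finset.range N, (N.choose m : ℝ)⁻¹ *
      ∑ M ∈ (Finset.univ : Finset ι).powersetCard m, piExp q (selInd (A := A) M I) := fun I =>
    mul_nonneg (by positivity) (Finset.sum_nonneg fun m _ => mul_nonneg (by positivity)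
      (Finset.sum_nonneg fun M _ => piExp_nonneg hq (selInd_nonneg M I)))
  calc _ ≤ ∑ I : Finset ι, β / N * ∑ m ∈ Finset.range N, (N.choose m : ℝ)⁻¹ *
        ∑ M ∈ (Finset.univ : Finset ι).powersetCard m, piExp q (selInd (A := A) M I) := by
        refine Finset.sum_le_sum fun I _ => ?_
        rcases (Finset.card_le_univ I).lt_or_eq with h | h
        · exact piExp_selInd_univ_le hq h1 I h hβ (hB _ h)
        · rw [h, ← hN, hB']
          simpa [piExp] using hnn I
    _ = β / N * ∑ m ∈ Finset.range N, (N.choose m : ℝ)⁻¹ *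
        ∑ M ∈ (Finset.univ : Finset ι).powersetCard m,
          ∑ I : Finset ι, piExp q (selInd (A := A) M I) := by
        rw [← Finset.mul_sum, Finset.sum_comm]
        congr 1
        refine Finset.sum_congr rfl fun m _ => ?_
        rw [← Finset.mul_sum, Finset.sum_comm]
    -- Every `M` selects exactly one `I`, so the inner sum counts the `C(N, m)` sets `M` of size
    -- `m`.
    _ = β / N * ∑ m ∈ Finset.range N, 1 := by
        congr 1
        refine Finset.sum_congr rfl fun m hm => ?_
        have hc : (0 : ℝ) < N.choose m := by
          exact_mod_cast Nat.choose_pos (Finset.mem_range.1 hm).le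
        have : ∀ M : Finset ι, ∑ I : Finset ι, piExp q (selInd (A := A) M I) = 1 := fun M => by
          rw [← piExp_sum]
          simp only [sum_selInd, piExp_one h1]
        simp only [this, Finset.sum_const, Finset.card_powersetCard, Finset.card_univ, ← hN,
          nsmul_eq_mul, mul_one]
        exact inv_mul_cancel₀ hc.ne'
    _ ≤ β := by
        rcases Nat.eq_zero_or_pos N with h | h
        · simp [h, hβ]
        · have : (0 : ℝ) < N := by exact_mod_cast h
          simp only [Finset.sum_const, Finset.card_range, nsmul_eq_mul, mul_one]
          rw [div_mul_cancel₀ _ this.ne']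

end Risk

/-! ### The scenario bound -/

/-- The polynomial is negative at `0`, and `s` lies to the left of its only root in `(0, 1)`. A
positive value at `s` would create another root in `(0, s)`. -/
theorem scenarioPoly_nonpos {k N : ℕ} (hk : k < N) {β : ℝ} (h0 : 0 < β) (h1 : β < 1) {s : ℝ}
    (hs : 0 < s) (hsb : scenarioBound k N β < 1 - s) : scenarioPoly k N β s ≤ 0 := by
  obtain ⟨t, ht, hu⟩ := existsUnique_scenarioPoly_root hk h0 h1
  have hset : {t : ℝ | t ∈ Ioo 0 1 ∧ scenarioPoly k N β t = 0} = {t} :=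
    Set.ext fun x => ⟨fun hx => hu x hx, fun hx => hx ▸ ht⟩
  rw [scenarioBound, if_pos hk, hset, csSup_singleton] at hsb
  by_contra! hpos
  have hN : (0 : ℝ) < N := by exact_mod_cast (Nat.zero_le k).trans_lt hk
  have hval0 : scenarioPoly k N β 0 < 0 := by
    have : ∑ i ∈ Finset.Ico k N, (i.choose k : ℝ) * (0 : ℝ) ^ (i - k) = 1 := by
      rw [Finset.sum_eq_single_of_mem k (by simp [hk])]
      · simp
      · intro i hi hik
        have : i - k ≠ 0 := by
          have := (Finset.mem_Ico.1 hi).1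
          omega
        simp [this]
    have hz : N - k ≠ 0 := by omega
    simp only [scenarioPoly, this, zero_pow hz, mul_zero, mul_one, zero_sub, Left.neg_neg_iff]
    positivity
  have hcont : Continuous (scenarioPoly k N β) := by
    unfold scenarioPoly
    fun_prop
  obtain ⟨r, hr, hr0⟩ := intermediate_value_Ioo hs.le hcont.continuousOn
    (show (0 : ℝ) ∈ Ioo _ _ from ⟨hval0, hpos⟩)
  have := hu r ⟨⟨hr.1, by linarith [hr.2, ht.1.2]⟩, hr0⟩
  linarith [hr.2]

/-! ### Maps with finitely many values -/

section Fibers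

variable {Ω A : Type*} [MeasurableSpace Ω] [Fintype A]

theorem measurableSet_preimage_of_fibers {a : Ω → A} (ha : ∀ v, MeasurableSet (a ⁻¹' {v}))
    (S : Set A) : MeasurableSet (a ⁻¹' S) := by
  rw [← biUnion_preimage_singleton]
  exact MeasurableSet.biUnion S.to_countable fun v _ => ha v

open Classical in
theorem measureReal_preimage_eq_sum {P : Measure Ω} [IsFiniteMeasure P] {a : Ω → A}
    (ha : ∀ v, MeasurableSet (a ⁻¹' {v})) (S : Set A) :
    P.real (a ⁻¹' S) = ∑ v, if v ∈ S then P.real (a ⁻¹' {v}) else 0 := by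
  rw [← Finset.sum_filter, ← measureReal_biUnion_finset _ fun v _ => ha v]
  · congr 1
    ext x
    simp
  · intro v _ w _ hvw
    exact Disjoint.preimage _ (by simpa using hvw)

theorem sum_measureReal_fibers {P : Measure Ω} [IsProbabilityMeasure P] {a : Ω → A}
    (ha : ∀ v, MeasurableSet (a ⁻¹' {v})) : ∑ v, P.real (a ⁻¹' {v}) = 1 := by
  have := measureReal_preimage_eq_sum (P := P) ha univ
  simpa using this.symm

-- The preimage is a finite disjoint union of boxes of fibres, so the product measure reduces to
-- finite weights.
open Classical in
theorem pi_measureReal_preimage_eq_piExp {ι : Type*} [Fintype ι] {P : Measure Ω}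
    [IsProbabilityMeasure P] {a : Ω → A} (ha : ∀ v, MeasurableSet (a ⁻¹' {v}))
    (S : Set (ι → A)) :
    (Measure.pi fun _ : ι => P).real ((fun ω i => a (ω i)) ⁻¹' S) =
      piExp (fun v => P.real (a ⁻¹' {v})) (S.indicator 1) := by
  have hfib : ∀ v : ι → A, (fun (ω : ι → Ω) i => a (ω i)) ⁻¹' {v} =
      univ.pi fun i => a ⁻¹' {v i} := by
    intro v
    ext ω
    simp [funext_iff]
  rw [measureReal_preimage_eq_sum, piExp_eq_sum]
  · refine Finset.sum_congr rfl fun v _ => ?_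
    rw [hfib, measureReal_def, Measure.pi_pi, ENNReal.toReal_prod]
    by_cases hv : v ∈ S <;> simp [hv, measureReal_def]
  · intro v
    rw [hfib]
    exact MeasurableSet.univ_pi fun i => ha (v i)

end Fibers

/-! ### The solution of the scenario program -/

section Program

variable {κ : Type*} [Fintype κ]

/-- The indicator of the union is the pointwise least feasible point, so a feasible point with the
same sum equals it. Off the union, nonnegativity comes from some constraint, whence `J` must be
nonempty. -/
theorem isScenarioSolution_indicator_iff {ι : Type*} (a : ι → Set κ) {J : Finset ι}
    (hJ : J.Nonempty) (θ : κ → ℝ) :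
    IsScenarioSolution (fun i => (a i).indicator 1) J θ ↔ θ = (J.sup a).indicator 1 := by
  have hfeas : ∀ i ∈ J, (a i).indicator (1 : κ → ℝ) ≤ (J.sup a).indicator 1 := fun i hi =>
    indicator_le_indicator_of_subset (Finset.le_sup (f := a) hi) fun _ => zero_le_one
  have hmin : ∀ θ' : κ → ℝ, (∀ i ∈ J, (a i).indicator 1 ≤ θ') →
      (J.sup a).indicator 1 ≤ θ' := by
    intro θ' h w
    by_cases hw : w ∈ J.sup a
    · obtain ⟨i, hi, hwi⟩ : ∃ i ∈ J, w ∈ a i := by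
        simpa [Finset.sup_set_eq_biUnion] using hw
      have := h i hi w
      rw [indicator_of_mem hwi] at this
      rwa [indicator_of_mem hw]
    · obtain ⟨i, hi⟩ := hJ
      rw [indicator_of_notMem hw]
      exact (indicator_nonneg (fun _ _ => zero_le_one) w).trans (h i hi w)
  constructor
  · rintro ⟨h1, h2⟩
    have hle := hmin θ h1
    have hsum := (Finset.sum_eq_sum_iff_of_le fun w _ => hle w).1
      (le_antisymm (Finset.sum_le_sum fun w _ => hle w) (h2 _ hfeas))
    exact funext fun w => (hsum w (Finset.mem_univ w)).symm
  · rintro rfl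
    exact ⟨hfeas, fun θ' h => Finset.sum_le_sum fun w _ => hmin θ' h w⟩

/-- Without constraints the objective is unbounded below, so complexity `0` cannot be attained. -/
theorem not_isScenarioSolution_empty [Nonempty κ] {ι : Type*} (δ : ι → κ → ℝ) (θ : κ → ℝ) :
    ¬ IsScenarioSolution δ ∅ θ := by
  rintro ⟨-, h⟩
  have := h (fun j => θ j - 1) (by simp)
  have hc : (0 : ℝ) < Fintype.card κ := by exact_mod_cast Fintype.card_pos
  simp only [Finset.sum_sub_distrib, Finset.sum_const, Finset.card_univ, nsmul_eq_mul,
    mul_one] at this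
  linarith

/-- The complexity is the size of the selected subfamily. -/
theorem complexity_indicator_eq_card [Nonempty κ] {N : ℕ} (hN : 0 < N) {a : Fin N → Set κ}
    (ha : ∀ i, (a i).Nonempty) {I : Finset (Fin N)} (hI : IsSelected Finset.univ a I) :
    complexity (fun i => (a i).indicator 1) = I.card := by
  have huniv : (Finset.univ : Finset (Fin N)).Nonempty := ⟨⟨0, hN⟩, Finset.mem_univ _⟩
  have hmem : I.card ∈ {m | ∃ J : Finset (Fin N), J.card = m ∧
      ∃ θ, IsScenarioSolution (fun i => (a i).indicator 1) J θ ∧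
        IsScenarioSolution (fun i => (a i).indicator 1) Finset.univ θ} := by
    have hIne : I.Nonempty := by
      rw [Finset.nonempty_iff_ne_empty]
      rintro rfl
      obtain ⟨w, hw⟩ := ha ⟨0, hN⟩
      have h : w ∈ (Finset.univ : Finset (Fin N)).sup a :=
        Finset.le_sup (f := a) (Finset.mem_univ (⟨0, hN⟩ : Fin N)) hw
      rw [← hI.2.1] at h
      simp at h
    refine ⟨I, rfl, (I.sup a).indicator 1, ?_, ?_⟩
    · rw [isScenarioSolution_indicator_iff a hIne]
    · rw [isScenarioSolution_indicator_iff a huniv, hI.2.1]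
  refine le_antisymm (Nat.sInf_le hmem) (le_csInf ⟨_, hmem⟩ ?_)
  rintro m ⟨J, rfl, θ, hJ, hu⟩
  rcases J.eq_empty_or_nonempty with rfl | hJne
  · exact absurd hJ (not_isScenarioSolution_empty _ θ)
  · rw [isScenarioSolution_indicator_iff a hJne] at hJ
    rw [isScenarioSolution_indicator_iff a huniv, hJ] at hu
    have hsup : J.sup a = Finset.univ.sup a := (indicator_one_inj ℝ hu)
    exact card_le_of_finsetRank_le (hI.2.2 J (Finset.subset_univ _) hsup)

end Program

/-! ### Blocks of trajectories, attractivity and infinite behaviours -/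

namespace OutputSystem

variable {n : ℕ} {Y : Type*} (Sys : OutputSystem n Y)

/-- The blocks of length `ℓ` of the trajectory of length `H` from `x`. -/
def blocks (H ℓ : ℕ) (x : Sys.D) : Set (Fin ℓ → Option Y) := {w | Exhibits (Sys.trajectory H x) w}

/-- Induction peels off the first step: the set for `t + 1` is the preimage under `f` of the set for
`t`, viewed in the ambient space. Points leaving `D` contribute nothing, as `none` is absorbing. -/
theorem measurableSet_iterate_step_mem (t : ℕ) {S : Set Sys.D} (hS : MeasurableSet S) :
    MeasurableSet {x : Sys.D | ∃ z ∈ S, Sys.step^[t] (some x) = some z} := by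
  have hnone : ∀ t, Sys.step^[t] none = none := fun t => Function.iterate_fixed rfl t
  induction t with
  | zero => simpa using hS
  | succ t ih =>
    convert Sys.measurable_f (Sys.measurableSet_D.subtype_image ih) using 1
    ext x
    simp only [Function.iterate_succ_apply, mem_ofPred_eq, mem_preimage, mem_image,
      Subtype.exists, exists_and_right, exists_eq_right]
    by_cases hx : Sys.f x ∈ Sys.D
    · simp [step, hx]
    · simp [step, hx, hnone]

theorem measurableSet_output_iterate_step (t : ℕ) (y : Option Y) :
    MeasurableSet {x : Sys.D | Sys.output (Sys.step^[t] (some x)) = y} := by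
  cases y with
  | none =>
    convert (Sys.measurableSet_iterate_step_mem t MeasurableSet.univ).compl using 1
    ext x
    cases h : Sys.step^[t] (some x) <;> simp [output, h]
  | some y =>
    convert Sys.measurableSet_iterate_step_mem t (Sys.measurable_h y) using 1
    ext x
    cases h : Sys.step^[t] (some x) <;> simp [output, h, and_comm]

/-- The set of blocks is a function of the output trajectory, which takes finitely many values on
measurable fibres. -/
theorem measurableSet_blocks_fiber [Finite Y] (H ℓ : ℕ) (v : Set (Fin ℓ → Option Y)) :
    MeasurableSet (Sys.blocks H ℓ ⁻¹' {v}) := by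
  have : Fintype (Fin H → Option Y) := Fintype.ofFinite _
  have htraj : ∀ r, MeasurableSet (Sys.trajectory H ⁻¹' {r}) := fun r => by
    have : Sys.trajectory H ⁻¹' {r} =
        ⋂ t : Fin H, {x : Sys.D | Sys.output (Sys.step^[t] (some x)) = r t} := by
      ext x
      simp [trajectory, funext_iff]
    rw [this]
    exact MeasurableSet.iInter fun t => Sys.measurableSet_output_iterate_step t (r t)
  exact measurableSet_preimage_of_fibers htraj {r | {w | Exhibits r w} = v}

/-- The block of length `ℓ` of the output sequence from `x`, from time `t` on. -/
noncomputable def blockAt (ℓ t : ℕ) (x : Sys.D) : Fin ℓ → Option Y :=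
  fun j => Sys.output (Sys.step^[t + j] (some x))

theorem mem_blocks_iff {H ℓ : ℕ} (hH : ℓ ≤ H) (x : Sys.D) (w : Fin ℓ → Option Y) :
    w ∈ Sys.blocks H ℓ x ↔ ∃ t ≤ H - ℓ, Sys.blockAt ℓ t x = w := by
  constructor
  · rintro ⟨t, ht, h⟩
    exact ⟨t, by omega, funext h⟩
  · rintro ⟨t, ht, rfl⟩
    exact ⟨t, by omega, fun _ => rfl⟩

theorem mem_pre_biUnion_eqClass_iff {ℓ : ℕ} (t : ℕ) (J : Set (Fin ℓ → Option Y)) (x : Sys.D) :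
    x ∈ Sys.pre t (⋃ w ∈ J, Sys.eqClass w) ↔ Sys.blockAt ℓ t x ∈ J := by
  have h : ∀ j, Sys.step^[j] (Sys.step^[t] (some x)) = Sys.step^[t + j] (some x) := fun j => by
    rw [add_comm, Function.iterate_add_apply]
  simp only [pre, eqClass, mem_ofPred_eq, mem_iUnion, h, exists_prop]
  constructor
  · rintro ⟨w, hw, e⟩
    rwa [show Sys.blockAt ℓ t x = w from (funext e).symm]
  · exact fun hx => ⟨_, hx, fun _ => rfl⟩

theorem witnessed_eq_sup {N : ℕ} (H ℓ : ℕ) (ω : Fin N → Sys.D) :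
    Sys.witnessed H ℓ ω = Finset.univ.sup fun i => Sys.blocks H ℓ (ω i) := by
  ext w
  simp [witnessed, blocks, Finset.sup_set_eq_biUnion]

/-- The sliding windows `blockAt ℓ t x` form the required run: consecutive windows overlap as the
domino rule demands. By determinism there is only one output sequence to match. -/
theorem behaviourallyIncludedIn_dominoSystem {ℓ : ℕ} (hℓ : 0 < ℓ)
    {W : Set (Fin ℓ → Option Y)} {x : Sys.D} (hx : ∀ t, Sys.blockAt ℓ t x ∈ W) :
    (Sys.embedding.startingAt (some x)).BehaviourallyIncludedIn (dominoSystem hℓ W) := by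
  rintro y ⟨r, ⟨h0, hstep⟩, hy⟩
  have hr : ∀ t, r t = Sys.step^[t] (some x) := by
    intro t
    induction t with
    | zero => exact h0
    | succ t ih =>
      rw [Function.iterate_succ_apply', ← ih]
      exact hstep t
  refine ⟨fun t => ⟨_, hx t⟩, ⟨mem_univ _, fun t i j hij => ?_⟩, fun t => ?_⟩
  · simp only [blockAt, hij]
    congr 2
    omega
  · rw [← hy t, hr t]
    rfl

/-- The classes of all `ℓ`-sequences cover the state space, so their union is hit at time `0`. -/
theorem attraction_le_one {P : Measure Sys.D} [IsProbabilityMeasure P] {ℓ : ℕ} {φ : ℕ → ℝ}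
    {k : ℕ} (hA : Sys.MeasureAttractive P ℓ φ k) : φ k ≤ 1 := by
  have h := hA.2 univ
  have huniv : (⋃ i, Sys.pre i (⋃ w ∈ (univ : Set (Fin ℓ → Option Y)), Sys.eqClass w)) = univ :=
    eq_univ_of_forall fun x =>
      mem_iUnion.2 ⟨0, (Sys.mem_pre_biUnion_eqClass_iff 0 univ x).2 (mem_univ _)⟩
  rw [hitEver, huniv, probReal_univ, mul_one] at h
  exact h.trans measureReal_le_one

/-- If the trajectories of length `H` have all blocks in `W` up to probability `ε`, then the
infinite behaviour is generated by `W` up to probability `ε / φ (H - ℓ)`. -/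
theorem one_sub_div_le_measureReal_included [Finite Y] {P : Measure Sys.D}
    [IsProbabilityMeasure P] {H ℓ : ℕ} (hℓ : 0 < ℓ) (hH : ℓ ≤ H) {φ : ℕ → ℝ}
    (hφ : 0 < φ (H - ℓ)) (hA : Sys.MeasureAttractive P ℓ φ (H - ℓ))
    (W : Set (Fin ℓ → Option Y)) {ε : ℝ}
    (hε : 1 - ε ≤ P.real {x | Sys.blocks H ℓ x ⊆ W}) :
    1 - ε / φ (H - ℓ) ≤ P.real {x | (Sys.embedding.startingAt (some x)).BehaviourallyIncludedIn
      (dominoSystem hℓ W)} := by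
  have : Fintype (Set (Fin ℓ → Option Y)) := Fintype.ofFinite _
  have hmeas : MeasurableSet {x | Sys.blocks H ℓ x ⊆ W} :=
    measurableSet_preimage_of_fibers (Sys.measurableSet_blocks_fiber H ℓ) {v | v ⊆ W}
  have hwithin : Sys.hitWithin P (H - ℓ) (⋃ w ∈ Wᶜ, Sys.eqClass w) ≤ ε := by
    have hset : (⋃ i ∈ Iic (H - ℓ), Sys.pre i (⋃ w ∈ Wᶜ, Sys.eqClass w)) =
        {x | Sys.blocks H ℓ x ⊆ W}ᶜ := by
      ext x
      rw [mem_iUnion₂]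
      simp only [Sys.mem_pre_biUnion_eqClass_iff]
      simp only [mem_compl_iff, mem_ofPred_eq, subset_def, Sys.mem_blocks_iff hH, mem_Iic,
        exists_prop]
      push Not
      constructor
      · rintro ⟨t, ht, h⟩
        exact ⟨_, ⟨t, ht, rfl⟩, h⟩
      · rintro ⟨_, ⟨t, ht, rfl⟩, h⟩
        exact ⟨t, ht, h⟩
    rw [hitWithin, hset, probReal_compl_eq_one_sub hmeas]
    linarith
  have hever : Sys.hitEver P (⋃ w ∈ Wᶜ, Sys.eqClass w) ≤ ε / φ (H - ℓ) := by
    rw [le_div_iff₀ hφ, mul_comm]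
    exact (hA.2 Wᶜ).trans hwithin
  -- A covering with subadditivity suffices, so measurability of the inclusion event is not needed.
  have hcover : univ ⊆ {x | (Sys.embedding.startingAt (some x)).BehaviourallyIncludedIn
      (dominoSystem hℓ W)} ∪ ⋃ i, Sys.pre i (⋃ w ∈ Wᶜ, Sys.eqClass w) := by
    intro x _
    by_cases hx : ∀ t, Sys.blockAt ℓ t x ∈ W
    · exact Or.inl (Sys.behaviourallyIncludedIn_dominoSystem hℓ hx)
    · push Not at hx
      obtain ⟨t, ht⟩ := hx
      exact Or.inr (mem_iUnion.2 ⟨t, (Sys.mem_pre_biUnion_eqClass_iff t Wᶜ x).2 ht⟩)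
  have := (measureReal_mono (μ := P) hcover).trans (measureReal_union_le _ _)
  rw [probReal_univ] at this
  unfold hitEver at hever
  linarith

end OutputSystem

/-! ### The probability bound for samples, and the main theorem -/

/-- The risk of the maximum of a sample of finitely valued scenarios exceeds the scenario bound
with probability at most `β`. -/
theorem one_sub_le_pi_measureReal_risk {Ω A : Type*} [MeasurableSpace Ω] [Fintype A]
    [SemilatticeSup A] [OrderBot A] {P : Measure Ω} [IsProbabilityMeasure P] {a : Ω → A}
    (ha : ∀ v, MeasurableSet (a ⁻¹' {v})) (N : ℕ) {β : ℝ} (h0 : 0 < β) (h1 : β < 1) :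
    1 - β ≤ (Measure.pi fun _ : Fin N => P).real {ω | ∀ I : Finset (Fin N),
      IsSelected Finset.univ (fun i => a (ω i)) I →
        1 - scenarioBound I.card N β ≤
          P.real {x | a x ≤ Finset.univ.sup fun i => a (ω i)}} := by
  classical
  set q : A → ℝ := fun v => P.real (a ⁻¹' {v}) with hq
  have hq0 : ∀ v, 0 ≤ q v := fun v => measureReal_nonneg
  have hq1 : ∑ v, q v = 1 := sum_measureReal_fibers ha
  have hmass : ∀ b : A, massBelow q b = P.real {x | a x ≤ b} := fun b => by
    refine Eq.trans ?_ (measureReal_preimage_eq_sum (P := P) ha {v | v ≤ b}).symm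
    simp only [massBelow, mem_ofPred_eq, hq]
  -- The condition `0 ≤ s` makes `B N` empty, since the bound is `1` at `k = N`.
  let B : ℕ → Set ℝ := fun k => {s | 0 ≤ s ∧ scenarioBound k N β < 1 - s}
  let G : Set (Fin N → A) := {v | ∀ I : Finset (Fin N), IsSelected Finset.univ v I →
    1 - scenarioBound I.card N β ≤ massBelow q (I.sup v)}
  have hG : {ω : Fin N → Ω | ∀ I : Finset (Fin N),
      IsSelected Finset.univ (fun i => a (ω i)) I →
        1 - scenarioBound I.card N β ≤
          P.real {x | a x ≤ Finset.univ.sup fun i => a (ω i)}} =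
      (fun ω i => a (ω i)) ⁻¹' G := by
    ext ω
    simp only [mem_ofPred_eq, mem_preimage, G]
    refine forall_congr' fun I => ⟨fun h hI => ?_, fun h hI => ?_⟩
    · rw [hmass, hI.2.1]
      exact h hI
    · rw [← hI.2.1, ← hmass]
      exact h hI
  rw [hG, pi_measureReal_preimage_eq_piExp ha]
  have hbad := piExp_bad_le (ι := Fin N) hq0 hq1 h0.le (B := B)
    (by
      rw [Fintype.card_fin]
      exact fun k hk s hs hpos => scenarioPoly_nonpos hk h0 h1 hpos hs.2)
    (by
      rw [Fintype.card_fin]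
      refine eq_empty_of_forall_notMem fun s hs => ?_
      have := hs.2
      rw [scenarioBound, if_neg (lt_irrefl N)] at this
      linarith [hs.1])
  -- Outside `G`, a selected `I` violating the bound contributes `1` to the sum.
  have hsplit : ∀ v : Fin N → A, (1 : ℝ) ≤ G.indicator 1 v + ∑ I : Finset (Fin N),
      (B I.card).indicator 1 (massBelow q (I.sup v)) * selInd Finset.univ I v := by
    intro v
    have hnn : ∀ I ∈ (Finset.univ : Finset (Finset (Fin N))),
        0 ≤ (B I.card).indicator 1 (massBelow q (I.sup v)) * selInd Finset.univ I v :=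
      fun I _ => mul_nonneg (indicator_nonneg (fun _ _ => zero_le_one) _) (selInd_nonneg _ _ _)
    by_cases hv : v ∈ G
    · rw [indicator_of_mem hv, Pi.one_apply]
      linarith [Finset.sum_nonneg hnn]
    · rw [indicator_of_notMem hv, zero_add]
      simp only [G, mem_ofPred_eq] at hv
      push Not at hv
      obtain ⟨I, hI, hlt⟩ := hv
      refine le_trans (le_of_eq ?_) (Finset.single_le_sum hnn (Finset.mem_univ I))
      have hmem : massBelow q (I.sup v) ∈ B I.card :=
        ⟨massBelow_nonneg hq0 _, by linarith⟩
      rw [indicator_of_mem hmem, selInd, if_pos hI]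
      simp
  have := piExp_mono hq0 hsplit
  rw [piExp_one hq1, piExp_add] at this
  linarith

theorem mainTheorem1 {n : ℕ} {Y : Type*} [Fintype Y] (Sys : OutputSystem n Y)
    (P : Measure Sys.D) [IsProbabilityMeasure P]
    (N H ℓ : ℕ) (hℓ : 0 < ℓ) (hH : ℓ ≤ H)
    (β : ℝ) (hβ0 : 0 < β) (hβ1 : β < 1)
    (φ : ℕ → ℝ) (hφ : 0 < φ (H - ℓ))
    (hA : Sys.MeasureAttractive P ℓ φ (H - ℓ)) :
    1 - β ≤ (Measure.pi fun _ : Fin N => P).real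
      {ω | 1 - scenarioBound (complexity fun i => Sys.scenario H ℓ (ω i)) N β / φ (H - ℓ) ≤
        P.real {x | (Sys.embedding.startingAt (some x)).BehaviourallyIncludedIn
          (Sys.dataDriven H hℓ ω)}} := by
  classical
  -- For `N = 0` the scenario bound is `1` whatever the complexity, and `φ (H - ℓ) ≤ 1` makes the
  -- claim trivial.
  rcases Nat.eq_zero_or_pos N with rfl | hN
  · have hle := Sys.attraction_le_one hA
    have : ∀ ω : Fin 0 → Sys.D,
        1 - scenarioBound (complexity fun i => Sys.scenario H ℓ (ω i)) 0 β / φ (H - ℓ) ≤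
          P.real {x | (Sys.embedding.startingAt (some x)).BehaviourallyIncludedIn
            (Sys.dataDriven H hℓ ω)} := by
      intro ω
      rw [scenarioBound, if_neg (Nat.not_lt_zero _)]
      refine le_trans ?_ measureReal_nonneg
      rw [sub_nonpos, one_le_div hφ]
      exact hle
    simp only [this, ofPred_true, probReal_univ]
    linarith
  · refine (one_sub_le_pi_measureReal_risk (P := P)
      (Sys.measurableSet_blocks_fiber H ℓ) N hβ0 hβ1).trans
      (measureReal_mono fun ω hω => ?_)
    obtain ⟨I, hI, -⟩ := existsUnique_isSelected Finset.univ fun i => Sys.blocks H ℓ (ω i)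
    -- Since `ℓ ≤ H`, each trajectory shows its block at time `0`; hence the selected subfamily is
    -- nonempty and its size is the complexity.
    have hne : ∀ i, (Sys.blocks H ℓ (ω i)).Nonempty := fun i =>
      ⟨_, (Sys.mem_blocks_iff hH _ _).2 ⟨0, Nat.zero_le _, rfl⟩⟩
    have hc : complexity (fun i => Sys.scenario H ℓ (ω i)) = I.card :=
      complexity_indicator_eq_card hN hne hI
    rw [mem_ofPred_eq, hc]
    refine Sys.one_sub_div_le_measureReal_included hℓ hH hφ hA _ ?_
    rw [Sys.witnessed_eq_sup]
    exact hω I hI
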